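/- There is an absolute constant $C$ such that for every $n \ge 1$ and every undirected connected graph $G=(V,E)$ on $n$ vertices, the minimum weight spanning tree problem on $G$ can be solved by a pure $(\min,\max,+)$ dynamic-programming algorithm performing at most $C n^3$ operations. That is, there is a circuit (straight-line program without conditional branching), depending only on $G$, whose inputs are the variables $x(e)$, $e\in E$, and the constant $0$, and which performs at most $C n^3$ binary operations, each of them $\min$, $\max$ or $+$, such that for every weighting $x:E\to\mathbb{R}_{\ge 0}$ the circuit outputs $$\min\Big\{\sum_{e\in T}x(e) : T\subseteq E \text{ is the edge set of a spanning tree of } G\Big\}.$$ -/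

import Mathlib

open scoped NNReal

universe u v

/-! ### Pure `(min, max, +)` dynamic-programming algorithms -/

/-- The basic operations of a pure `(min, max, +)` algorithm. -/
inductive PureOp where
  | min
  | max
  | add

/-- The action of a basic operation on two nonnegative reals. -/
noncomputable def PureOp.apply : PureOp → ℝ≥0 → ℝ≥0 → ℝ≥0
  | .min, a, b => Min.min a b
  | .max, a, b => Max.max a b
  | .add, a, b => a + b

/-- An operand that is available once `s` operations have been performed: an input variable
`i : ι`, the constant `0`, or the result of one of these `s` operations. -/
inductive PureOperand (ι : Type v) (s : ℕ) where
  | input (i : ι)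
  | zero
  | result (k : Fin s)

/-- A pure `(min, max, +)` program with input variables indexed by `ι` that performs exactly `s`
binary operations: a straight-line program (equivalently, a circuit with `s` gates of fan-in two
and unrestricted fan-out). Each operation is applied to operands that were fixed in advance, so
that there is no branching and nothing depends on the values of the inputs. -/
inductive PureProgram (ι : Type v) : ℕ → Type v where
  | nil : PureProgram ι 0
  | step {s : ℕ} (P : PureProgram ι s) (o : PureOp) (a b : PureOperand ι s) : PureProgram ι (s + 1)

/-- The value of an operand, given the input and the results of the first `s` operations. -/
def PureOperand.value {ι : Type v} {s : ℕ} (x : ι → ℝ≥0) (r : Fin s → ℝ≥0) :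
    PureOperand ι s → ℝ≥0
  | .input i => x i
  | .zero => 0
  | .result k => r k

/-- The results of all operations of a pure program on the input `x`, in the order in which they
are performed. -/
noncomputable def PureProgram.results {ι : Type v} (x : ι → ℝ≥0) :
    {s : ℕ} → PureProgram ι s → Fin s → ℝ≥0
  | _, .nil => Fin.elim0
  | _, .step P o a b =>
      Fin.snoc (α := fun _ => ℝ≥0) (P.results x)
        (o.apply (a.value x (P.results x)) (b.value x (P.results x)))

/-- A pure `(min, max, +)` algorithm: a pure program together with the operand that it outputs. -/
structure PureAlgorithm (ι : Type v) where
  /-- The number of performed operations. -/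
  numOps : ℕ
  /-- The sequence of operations. -/
  program : PureProgram ι numOps
  /-- The operand whose value is the output. -/
  out : PureOperand ι numOps

/-- The output of a pure algorithm on the input `x`. -/
noncomputable def PureAlgorithm.eval {ι : Type v} (A : PureAlgorithm ι) (x : ι → ℝ≥0) : ℝ≥0 :=
  A.out.value x (A.program.results x)

/-! ### The minimum weight spanning tree problem -/

/-- `T` is a spanning tree of `G`: a tree on the whole vertex set, all of whose edges are edges
of `G`. -/
def IsSpanningTree {V : Type u} (G T : SimpleGraph V) : Prop :=
  T ≤ G ∧ T.IsTree

open Classical in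
/-- The `x`-weight of a subgraph `T` of `G` under a weighting `x` of the edges of `G`: the sum of
the weights of those edges of `G` that belong to `T`. -/
noncomputable def treeWeight {V : Type u} [Fintype V] {G : SimpleGraph V}
    (x : G.edgeSet → ℝ≥0) (T : SimpleGraph V) : ℝ≥0 :=
  ∑ e ∈ Finset.univ.filter (fun e : G.edgeSet => e.1 ∈ T.edgeSet), x e

/-- `w` is the minimum `x`-weight of a spanning tree of `G`. -/
def IsMSTWeight {V : Type u} [Fintype V] (G : SimpleGraph V) (x : G.edgeSet → ℝ≥0) (w : ℝ≥0) :
    Prop :=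
  IsLeast {w' : ℝ≥0 | ∃ T : SimpleGraph V, IsSpanningTree G T ∧ treeWeight x T = w'} w

/-- The pure algorithm `A`, whose input variables are the edges of `G`, solves the minimum weight
spanning tree problem on `G`: on every weighting of the edges of `G` by nonnegative reals it
outputs the minimum weight of a spanning tree. -/
def PureAlgorithm.SolvesMST {V : Type u} [Fintype V] {G : SimpleGraph V}
    (A : PureAlgorithm G.edgeSet) : Prop :=
  ∀ x : G.edgeSet → ℝ≥0, IsMSTWeight G x (A.eval x)

/-! Let D u v be the bottleneck distance: the minimum, over paths from u to v, of the largest edge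
weight on the path. Floyd–Warshall over (min, max) computes D in O(n^3) operations, and D satisfies
the ultrametric inequality. This makes Prim's data-dependent choices superfluous: with the vertices
in any fixed order, attaching each one to its D-nearest successor costs exactly the minimum spanning
tree weight, so no branching is needed.

No tree is cheaper (`attachCost_le_sum`): contract the first vertex along an incident edge with
least D; by the ultrametric inequality D does not grow on the other edges, and induction applies.
Some tree is as cheap (`exists_sum_le_attachCost`): each attachment of v to t can be exchanged for
an edge of weight at most D v t. Connectedness is phrased by cuts (predicates on vertices), which
turns contraction into composition and exchange into a parity argument. -/

/-! ### Sets of functions computed by a pure program -/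

/-- Some pure program with at most `N` operations computes all functions in `F`. -/
def PureComputable {ι : Type v} (N : ℕ) (F : Set ((ι → ℝ≥0) → ℝ≥0)) : Prop :=
  ∃ s ≤ N, ∃ P : PureProgram ι s, ∀ f ∈ F, ∃ a : PureOperand ι s,
    ∀ x, a.value x (P.results x) = f x

namespace PureComputable

variable {ι : Type v} {N : ℕ} {F : Set ((ι → ℝ≥0) → ℝ≥0)}

lemma mono {N' : ℕ} {F' : Set ((ι → ℝ≥0) → ℝ≥0)} (h : PureComputable N F) (hN : N ≤ N')
    (hF : F' ⊆ F) : PureComputable N' F' := by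
  obtain ⟨s, hs, P, hP⟩ := h
  exact ⟨s, hs.trans hN, P, fun f hf => hP f (hF hf)⟩

lemma inputs : PureComputable 0 (insert (fun _ => 0) (Set.range fun (i : ι) x => x i)) := by
  refine ⟨0, le_rfl, .nil, ?_⟩
  rintro f (rfl | ⟨i, rfl⟩)
  · exact ⟨.zero, fun _ => rfl⟩
  · exact ⟨.input i, fun _ => rfl⟩

lemma op (h : PureComputable N F) (o : PureOp) {f g : (ι → ℝ≥0) → ℝ≥0} (hf : f ∈ F)
    (hg : g ∈ F) : PureComputable (N + 1) (insert (fun x => o.apply (f x) (g x)) F) := by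
  obtain ⟨s, hs, P, hP⟩ := h
  obtain ⟨a, ha⟩ := hP f hf
  obtain ⟨b, hb⟩ := hP g hg
  refine ⟨s + 1, by omega, .step P o a b, ?_⟩
  rintro k (rfl | hk)
  · refine ⟨.result (Fin.last s), fun x => ?_⟩
    simp only [PureOperand.value, PureProgram.results, Fin.snoc_last]
    exact congrArg₂ o.apply (ha x) (hb x)
  · obtain ⟨c, hc⟩ := hP k hk
    cases c with
    | input i => exact ⟨.input i, hc⟩
    | zero => exact ⟨.zero, hc⟩
    | result j =>
      refine ⟨.result j.castSucc, fun x => ?_⟩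
      rw [← hc x]
      simp [PureOperand.value, PureProgram.results]

lemma layer {κ : Type*} (o : PureOp) (f g : κ → (ι → ℝ≥0) → ℝ≥0) (h : PureComputable N F) :
    ∀ L : List κ, (∀ k ∈ L, f k ∈ F ∧ g k ∈ F) →
      PureComputable (N + L.length) (F ∪ {e | ∃ k ∈ L, e = fun x => o.apply (f k x) (g k x)})
  | [], _ => h.mono (by simp) (by simp)
  | k :: L, hL => by
    have ih := layer o f g h L fun j hj => hL j (List.mem_cons_of_mem _ hj)
    have hk := hL k List.mem_cons_self
    refine (ih.op o (Or.inl hk.1) (Or.inl hk.2)).mono (by simp [add_assoc]) ?_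
    rintro e (he | ⟨j, hj, rfl⟩)
    · exact Or.inr (Or.inl he)
    · rcases List.mem_cons.1 hj with rfl | hj
      · exact Or.inl rfl
      · exact Or.inr (Or.inr ⟨j, hj, rfl⟩)

lemma foldr {κ : Type*} (o : PureOp) (f : κ → (ι → ℝ≥0) → ℝ≥0) {g : (ι → ℝ≥0) → ℝ≥0}
    (h : PureComputable N F) (hg : g ∈ F) :
    ∀ L : List κ, (∀ k ∈ L, f k ∈ F) →
      PureComputable (N + L.length)
        (insert (fun x => L.foldr (fun k m => o.apply (f k x) m) (g x)) F)
  | [], _ => h.mono (by simp) (by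
      rintro e (rfl | he)
      · exact hg
      · exact he)
  | k :: L, hL => by
    have ih := foldr o f h hg L fun j hj => hL j (List.mem_cons_of_mem _ hj)
    refine (ih.op o (Or.inr (hL k List.mem_cons_self)) (Or.inl rfl)).mono
      (by simp [add_assoc]) ?_
    rintro e (rfl | he)
    · exact Or.inl rfl
    · exact Or.inr (Or.inr he)

lemma exists_algorithm {f : (ι → ℝ≥0) → ℝ≥0} (h : PureComputable N F) (hf : f ∈ F) :
    ∃ A : PureAlgorithm ι, A.numOps ≤ N ∧ ∀ x, A.eval x = f x := by
  obtain ⟨s, hs, P, hP⟩ := h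
  obtain ⟨a, ha⟩ := hP f hf
  exact ⟨⟨s, P, a⟩, hs, ha⟩

end PureComputable

/-! ### Bottleneck distances -/

/-- One round of the `(min, max)` Floyd–Warshall algorithm, allowing detours through `w`. -/
noncomputable def relax {V : Type u} (w : V) (D : V → V → ℝ≥0) (a b : V) : ℝ≥0 :=
  min (D a b) (max (D a w) (D w b))

/-- All rounds of the `(min, max)` Floyd–Warshall algorithm. -/
noncomputable def relaxAll {V : Type u} (l : List V) (D : V → V → ℝ≥0) : V → V → ℝ≥0 :=
  l.foldr relax D

section Relax

variable {V : Type u}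

lemma relaxAll_le (l : List V) (D : V → V → ℝ≥0) (a b : V) : relaxAll l D a b ≤ D a b := by
  induction l with
  | nil => exact le_rfl
  | cons w l ih => exact (min_le_left _ _).trans ih

lemma relaxAll_self {D : V → V → ℝ≥0} (h : ∀ a, D a a = 0) (l : List V) (a : V) :
    relaxAll l D a a = 0 :=
  le_antisymm ((relaxAll_le l D a a).trans (h a).le) (zero_le)

lemma relaxAll_comm {D : V → V → ℝ≥0} (h : ∀ a b, D a b = D b a) (l : List V) :
    ∀ a b, relaxAll l D a b = relaxAll l D b a := by
  induction l with
  | nil => exact h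
  | cons w l ih =>
    intro a b
    change relax w (relaxAll l D) a b = relax w (relaxAll l D) b a
    unfold relax
    rw [ih a b, ih a w, ih w b, max_comm]

/-- Round w creates the inequality through w, and every later round preserves it. The fold is from
the right, so the head of the list is the last round. -/
lemma relaxAll_le_max (D : V → V → ℝ≥0) (l : List V) :
    ∀ w ∈ l, ∀ a b, relaxAll l D a b ≤ max (relaxAll l D a w) (relaxAll l D w b) := by
  induction l with
  | nil => simp
  | cons v l ih =>
    intro w hw a b
    change relax v (relaxAll l D) a b ≤
      max (relax v (relaxAll l D) a w) (relax v (relaxAll l D) w b)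
    generalize relaxAll l D = D at ih
    unfold relax
    rcases List.mem_cons.1 hw with rfl | hw
    · rw [min_eq_left (le_max_left (D a w) _), min_eq_left (le_max_right _ (D w b))]
      exact min_le_right _ _
    · have h1 := ih w hw a b
      have h2 := ih w hw a v
      have h3 := ih w hw v b
      grind

end Relax

/-- `S` is not cut by the pairs `(a k, b k)` with `P k`. -/
def Uncut {V : Type u} {κ : Type v} (P : κ → Prop) (a b : κ → V) (S : V → Prop) : Prop :=
  ∀ k, P k → (S (a k) ↔ S (b k))

/-- Every set that is not cut by pairs of weight at most `D u v` contains both or none of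
`u` and `v`. -/
def BottleneckRealized {V : Type u} {κ : Type v} (a b : κ → V) (c : κ → ℝ≥0)
    (D : V → V → ℝ≥0) : Prop :=
  ∀ u v S, Uncut (fun k => c k ≤ D u v) a b S → (S u ↔ S v)

/-- A detour through w weighs at least as much as each leg, so the pairs allowed for the detour
include those allowed for either leg. -/
lemma BottleneckRealized.relaxAll {V : Type u} {κ : Type v} {a b : κ → V} {c : κ → ℝ≥0}
    {D : V → V → ℝ≥0} (h : BottleneckRealized a b c D) (l : List V) :
    BottleneckRealized a b c (relaxAll l D) := by
  induction l with
  | nil => exact h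
  | cons w l ih =>
    intro u v S hS
    change Uncut (fun k => c k ≤ min (_root_.relaxAll l D u v)
      (max (_root_.relaxAll l D u w) (_root_.relaxAll l D w v))) a b S at hS
    rcases min_choice (_root_.relaxAll l D u v)
      (max (_root_.relaxAll l D u w) (_root_.relaxAll l D w v)) with h' | h' <;> rw [h'] at hS
    · exact ih u v S hS
    · exact (ih u w S fun k hk => hS k (hk.trans (le_max_left _ _))).trans
        (ih w v S fun k hk => hS k (hk.trans (le_max_right _ _)))

/-! ### Attaching points one by one -/

/-- The distance from `v` to the nearest point of `u :: l`. -/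
noncomputable def nearest {V : Type u} (D : V → V → ℝ≥0) (v u : V) (l : List V) : ℝ≥0 :=
  l.foldr (fun w m => min (D v w) m) (D v u)

/-- The cost of attaching every point of a list to the nearest point that comes later. -/
noncomputable def attachCost {V : Type u} (D : V → V → ℝ≥0) : List V → ℝ≥0
  | [] => 0
  | [_] => 0
  | v :: u :: l => nearest D v u l + attachCost D (u :: l)

section Attach

variable {V : Type u} {κ : Type v} {D : V → V → ℝ≥0}

lemma nearest_le (v u : V) (l : List V) : ∀ w ∈ u :: l, nearest D v u l ≤ D v w := by
  induction l with
  | nil => simp [nearest]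
  | cons t l ih =>
    have e : nearest D v u (t :: l) = min (D v t) (nearest D v u l) := rfl
    simp only [List.mem_cons] at ih ⊢
    rintro w (rfl | rfl | hw)
    · exact e ▸ (min_le_right _ _).trans (ih _ (Or.inl rfl))
    · exact e ▸ min_le_left _ _
    · exact e ▸ (min_le_right _ _).trans (ih _ (Or.inr hw))

lemma exists_nearest_eq (v u : V) (l : List V) : ∃ w ∈ u :: l, nearest D v u l = D v w := by
  induction l with
  | nil => exact ⟨u, by simp, rfl⟩
  | cons t l ih =>
    have e : nearest D v u (t :: l) = min (D v t) (nearest D v u l) := rfl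
    obtain ⟨w, hw, h⟩ := ih
    rcases min_choice (D v t) (nearest D v u l) with h' | h'
    · exact ⟨t, by simp, e.trans h'⟩
    · exact ⟨w, by grind, by rw [e, h', h]⟩

open Classical in
/-- In an ultrametric, attaching the points one by one in any order is at most as expensive as
any connected family of pairs. -/
lemma attachCost_le_sum (h0 : ∀ a, D a a = 0) (hs : ∀ a b, D a b = D b a)
    (hu : ∀ w a b, D a b ≤ max (D a w) (D w b)) {c : κ → ℝ≥0} :
    ∀ (l : List V) (a b : κ → V) (s : Finset κ), l.Nodup → (∀ k ∈ s, a k ∈ l ∧ b k ∈ l) →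
      (∀ k ∈ s, D (a k) (b k) ≤ c k) →
      (∀ S, Uncut (· ∈ s) a b S → ∀ p ∈ l, ∀ q ∈ l, (S p ↔ S q)) →
      attachCost D l ≤ ∑ k ∈ s, c k
  | [], _, _, _, _, _, _, _ => zero_le
  | [_], _, _, _, _, _, _, _ => zero_le
  | v :: u :: l, a, b, s, hl, hab, hc, hconn => by
    have hvl : v ∉ u :: l := (List.nodup_cons.1 hl).1
    -- The pairs that cross the cut around v; m is the one with least D, and t is its other
    -- endpoint.
    set X := s.filter fun k => ¬ (a k = v ↔ b k = v) with hX
    have hne : X.Nonempty := by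
      by_contra hemp
      have hcut : Uncut (· ∈ s) a b (· = v) := fun k hk => by
        by_contra hk'
        exact hemp ⟨k, Finset.mem_filter.2 ⟨hk, hk'⟩⟩
      have := (hconn _ hcut v (by simp) u (by simp)).1 rfl
      exact hvl (by simp [this])
    obtain ⟨m, hm, hmin⟩ := X.exists_min_image (fun k => D (a k) (b k)) hne
    obtain ⟨hms, hmv⟩ := Finset.mem_filter.1 hm
    obtain ⟨t, htl, hta, htD⟩ : ∃ t ∈ u :: l,
        ((a m = v ∧ b m = t) ∨ (a m = t ∧ b m = v)) ∧ D (a m) (b m) = D v t := by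
      have := hab m hms
      by_cases h : a m = v
      · exact ⟨b m, by grind, Or.inl ⟨h, rfl⟩, by rw [h]⟩
      · exact ⟨a m, by grind, by grind, by grind⟩
    have htv : t ≠ v := fun h => hvl (h ▸ htl)
    -- Contract v into t: m becomes a loop and is erased. A crossing pair moved from v to t keeps
    -- its bound, since D v t is at most its old D.
    set φ : V → V := fun w => if w = v then t else w with hφ
    have hφl : ∀ w ∈ v :: u :: l, φ w ∈ u :: l := by grind
    have ih := attachCost_le_sum h0 hs hu (c := c) (u :: l) (φ ∘ a) (φ ∘ b) (s.erase m)
      (List.nodup_cons.1 hl).2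
      (fun k hk => ⟨hφl _ (hab k (Finset.mem_of_mem_erase hk)).1,
        hφl _ (hab k (Finset.mem_of_mem_erase hk)).2⟩)
      (fun k hk => by
        have hks := Finset.mem_of_mem_erase hk
        refine le_trans ?_ (hc k hks)
        by_cases hkX : k ∈ X
        · have hle : D v t ≤ D (a k) (b k) := htD ▸ hmin k hkX
          have hk2 := (Finset.mem_filter.1 hkX).2
          by_cases hak : a k = v
          · have hbk : b k ≠ v := fun h => hk2 ⟨fun _ => h, fun _ => hak⟩
            simp only [Function.comp, hφ, hak, hbk, if_true, if_false] at hle ⊢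
            exact (hu v t (b k)).trans (max_le (hs t v ▸ hle) le_rfl)
          · have hbk : b k = v := by tauto
            simp only [Function.comp, hφ, hak, hbk, if_true, if_false] at hle ⊢
            exact (hu v (a k) t).trans (max_le le_rfl hle)
        · have hk2 : a k = v ↔ b k = v := by
            by_contra h
            exact hkX (Finset.mem_filter.2 ⟨hks, h⟩)
          by_cases hak : a k = v
          · simp [hφ, hak, hk2.1 hak, h0]
          · have hbk : b k ≠ v := fun h => hak (hk2.2 h)
            simp [hφ, hak, hbk])
      (fun S hS p hp q hq => by
        have hS' : Uncut (· ∈ s) a b fun w => S (φ w) := fun k hk => by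
          by_cases hkm : k = m
          · subst hkm
            rcases hta with ⟨h1, h2⟩ | ⟨h1, h2⟩ <;> simp [hφ, h1, h2]
          · exact hS k (Finset.mem_erase.2 ⟨hkm, hk⟩)
        have := hconn _ hS' p (List.mem_cons_of_mem _ hp) q (List.mem_cons_of_mem _ hq)
        have hpv : p ≠ v := fun h => hvl (h ▸ hp)
        have hqv : q ≠ v := fun h => hvl (h ▸ hq)
        simpa [hφ, hpv, hqv] using this)
    calc attachCost D (v :: u :: l) = nearest D v u l + attachCost D (u :: l) := rfl
      _ ≤ c m + ∑ k ∈ s.erase m, c k :=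
        add_le_add ((nearest_le v u l t htl).trans (htD ▸ hc m hms)) ih
      _ = ∑ k ∈ s, c k := Finset.add_sum_erase s c hms

lemma iff_iff_iff_of_not_iff {p q r s : Prop} (h : ¬ (p ↔ q)) (h' : ¬ (r ↔ s)) :
    (p ↔ r) ↔ (q ↔ s) := by
  tauto

lemma not_iff_iff_iff_of_iff {p q r s : Prop} (h : p ↔ q) (h' : ¬ (r ↔ s)) :
    ¬ ((p ↔ r) ↔ (q ↔ s)) := by
  tauto

/-- `S` contains all points or none. -/
def TrivialCut (S : V → Prop) : Prop := ∀ p q, S p ↔ S q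

open Classical in
/-- If bottleneck distances are realized by weighted pairs, then some connected family of these
pairs costs at most as much as attaching the points one by one. Here `B` lists the pairs of points
that have been connected already. -/
lemma exists_sum_le_attachCost {a b : κ → V} {c : κ → ℝ≥0}
    (hD : BottleneckRealized a b c D) :
    ∀ (l : List V) (B : V → V → Prop),
      (∀ S : V → Prop, (∀ p q, B p q → (S p ↔ S q)) → (∀ p ∈ l, ∀ q ∈ l, (S p ↔ S q)) →
        TrivialCut S) →
      ∃ s : Finset κ, ∑ k ∈ s, c k ≤ attachCost D l ∧
        ∀ S : V → Prop, (∀ p q, B p q → (S p ↔ S q)) → Uncut (· ∈ s) a b S → TrivialCut S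
  | [], _, hB => ⟨∅, by simp, fun S hS _ => hB S hS (by simp)⟩
  | [_], _, hB => ⟨∅, by simp, fun S hS _ => hB S hS (by simp)⟩
  | v :: u :: l, B, hB => by
    obtain ⟨t, htl, ht⟩ := exists_nearest_eq (D := D) v u l
    obtain ⟨s, hsum, hs⟩ := exists_sum_le_attachCost hD (u :: l)
      (fun p q => B p q ∨ (p = v ∧ q = t)) (fun S hS hl => by
        refine hB S (fun p q h => hS p q (Or.inl h)) ?_
        have hvt := hS v t (Or.inr ⟨rfl, rfl⟩)
        have key : ∀ p ∈ v :: u :: l, (S p ↔ S t) := by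
          intro p hp
          rcases List.mem_cons.1 hp with rfl | hp
          · exact hvt
          · exact hl p hp t htl
        exact fun p hp q hq => (key p hp).trans (key q hq).symm)
    -- If s connects everything without the link from v to t, it suffices. Otherwise some nontrivial
    -- cut S₀ respects B and s; it must separate v from t, so a pair m of weight at most D v t
    -- crosses it and replaces the link.
    by_cases hdone : ∀ S : V → Prop, (∀ p q, B p q → (S p ↔ S q)) → Uncut (· ∈ s) a b S →
        TrivialCut S
    · exact ⟨s, hsum.trans (le_add_of_nonneg_left zero_le), hdone⟩
    push Not at hdone
    obtain ⟨S₀, hB₀, hs₀, hS₀⟩ := hdone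
    have hvt : ¬ (S₀ v ↔ S₀ t) := fun h => hS₀ (hs S₀ (by
      rintro p q (h' | ⟨rfl, rfl⟩)
      · exact hB₀ p q h'
      · exact h) hs₀)
    obtain ⟨m, hm, hmS⟩ : ∃ m, c m ≤ D v t ∧ ¬ (S₀ (a m) ↔ S₀ (b m)) := by
      by_contra! h
      exact hvt (hD v t S₀ h)
    refine ⟨insert m s, ?_, fun S hBS hS => ?_⟩
    · refine le_trans ?_ (add_le_add (ht.symm ▸ hm) hsum)
      by_cases hms : m ∈ s
      · rw [Finset.insert_eq_of_mem hms]
        exact le_add_of_nonneg_left zero_le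
      · rw [Finset.sum_insert hms]
    · have hsS : Uncut (· ∈ s) a b S := fun k hk => hS k (Finset.mem_insert_of_mem hk)
      by_cases hvtS : S v ↔ S t
      · refine hs S ?_ hsS
        rintro p q (h' | ⟨rfl, rfl⟩)
        · exact hBS p q h'
        · exact hvtS
      · exfalso
        -- If S also separated v from t, the agreement set of S and S₀ would respect B, s and the
        -- link, hence be trivial; but m crosses S₀ and not S.
        have hdiff : TrivialCut fun p => (S p ↔ S₀ p) := by
          refine hs _ ?_ fun k hk => ?_
          · rintro p q (h' | ⟨rfl, rfl⟩)
            · exact iff_congr (hBS p q h') (hB₀ p q h')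
            · exact iff_iff_iff_of_not_iff hvtS hvt
          · exact iff_congr (hsS k hk) (hs₀ k hk)
        exact not_iff_iff_iff_of_iff (hS m (Finset.mem_insert_self m s)) hmS (hdiff (a m) (b m))

end Attach

/-! ### The algorithm for spanning trees -/

section Graph

variable {V : Type u}

open Classical in
/-- The weight of the edge `uv`, and `d` for pairs that are not edges. -/
noncomputable def edgeWeight (G : SimpleGraph V) (x : G.edgeSet → ℝ≥0) (d : ℝ≥0) (u v : V) :
    ℝ≥0 :=
  if h : G.Adj u v then x ⟨s(u, v), h⟩ else d

/-- The maximum weight of an edge. -/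
noncomputable def maxWeight [Fintype V] (G : SimpleGraph V) (x : G.edgeSet → ℝ≥0) : ℝ≥0 :=
  (Finset.univ : Finset (V × V)).toList.foldr (fun p m => max (edgeWeight G x 0 p.1 p.2) m) 0

open Classical in
/-- The initial distances of the `(min, max)` Floyd–Warshall algorithm. -/
noncomputable def initialDist [Fintype V] (G : SimpleGraph V) (x : G.edgeSet → ℝ≥0) (u v : V) : ℝ≥0 :=
  if u = v then 0 else edgeWeight G x (maxWeight G x) u v

/-- The bottleneck distances of a weighted graph. -/
noncomputable def bottleneckDist [Fintype V] (G : SimpleGraph V) (x : G.edgeSet → ℝ≥0) : V → V → ℝ≥0 :=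
  relaxAll (Finset.univ : Finset V).toList (initialDist G x)

variable {G : SimpleGraph V} {x : G.edgeSet → ℝ≥0}

lemma edgeWeight_comm (d : ℝ≥0) (u v : V) : edgeWeight G x d u v = edgeWeight G x d v u := by
  unfold edgeWeight
  by_cases h : G.Adj u v
  · simp only [h, h.symm, dif_pos, Sym2.eq_swap (a := u)]
  · rw [dif_neg h, dif_neg fun h' => h h'.symm]

open Classical in
lemma initialDist_comm [Fintype V] (u v : V) : initialDist G x u v = initialDist G x v u := by
  unfold initialDist
  rw [edgeWeight_comm]
  exact if_congr eq_comm rfl rfl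

lemma le_maxWeight [Fintype V] (e : G.edgeSet) : x e ≤ maxWeight G x := by
  have aux : ∀ (L : List (V × V)), ∀ p ∈ L, edgeWeight G x 0 p.1 p.2 ≤
      L.foldr (fun p m => max (edgeWeight G x 0 p.1 p.2) m) 0 := by
    intro L
    induction L with
    | nil => simp
    | cons q L ih =>
      intro p hp
      rcases List.mem_cons.1 hp with rfl | hp
      · exact le_max_left _ _
      · exact (ih p hp).trans (le_max_right _ _)
  obtain ⟨e, he⟩ := e
  induction e with
  | h u v =>
    have := aux Finset.univ.toList (u, v) (by simp)
    have hadj : G.Adj u v := he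
    rwa [edgeWeight, dif_pos hadj] at this

/-- A chosen ordering of the endpoints of an edge. -/
noncomputable def endpoints (e : G.edgeSet) : V × V := Quot.out e.1

lemma mk_endpoints (e : G.edgeSet) : s((endpoints e).1, (endpoints e).2) = e.1 :=
  Quot.out_eq e.1

lemma adj_endpoints (e : G.edgeSet) : G.Adj (endpoints e).1 (endpoints e).2 := by
  rw [← SimpleGraph.mem_edgeSet, mk_endpoints]
  exact e.2

lemma uncut_endpoints {P : G.edgeSet → Prop} {S : V → Prop}
    (h : Uncut P (fun e => (endpoints e).1) (fun e => (endpoints e).2) S) {u v : V}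
    (huv : G.Adj u v) (hP : P ⟨s(u, v), huv⟩) : S u ↔ S v := by
  have h1 := h _ hP
  have h2 := mk_endpoints (⟨s(u, v), huv⟩ : G.edgeSet)
  rcases Sym2.eq_iff.1 h2 with ⟨h3, h4⟩ | ⟨h3, h4⟩
  · simpa only [h3, h4] using h1
  · simpa only [h3, h4] using h1.symm

lemma trivialCut_of_connected {H : SimpleGraph V} (hH : H.Connected) {S : V → Prop}
    (hS : ∀ u v, H.Adj u v → (S u ↔ S v)) : TrivialCut S := by
  intro p q
  obtain ⟨w⟩ := hH.preconnected p q
  induction w with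
  | nil => rfl
  | cons h _ ih => exact (hS _ _ h).trans ih

lemma bottleneckRealized_initialDist [Fintype V] (hG : G.Connected) :
    BottleneckRealized (fun e : G.edgeSet => (endpoints e).1) (fun e => (endpoints e).2) x
      (initialDist G x) := by
  intro u v S hS
  by_cases huv : u = v
  · rw [huv]
  by_cases hadj : G.Adj u v
  · exact uncut_endpoints hS hadj (by simp [initialDist, edgeWeight, huv, hadj])
  · refine trivialCut_of_connected hG (fun p q hpq => uncut_endpoints hS hpq ?_) u v
    -- The maximum weight stands in for infinity at non-edges: under this threshold all edges are
    -- allowed, and G is connected.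
    simpa [initialDist, edgeWeight, huv, hadj] using le_maxWeight _

lemma attachCost_le_treeWeight [Fintype V] {T : SimpleGraph V} (hT : IsSpanningTree G T) :
    attachCost (bottleneckDist G x) (Finset.univ : Finset V).toList ≤ treeWeight x T := by
  refine attachCost_le_sum (relaxAll_self (by simp [initialDist]) _)
    (relaxAll_comm initialDist_comm _) (fun w => relaxAll_le_max _ _ w (by simp)) _
    (fun e => (endpoints e).1) (fun e => (endpoints e).2) _ (Finset.nodup_toList _)
    (by simp) (fun e _ => ?_) (fun S hS p _ q _ => ?_)
  · refine (relaxAll_le _ _ _ _).trans (le_of_eq ?_)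
    have := adj_endpoints e
    have hx : x ⟨s((endpoints e).1, (endpoints e).2), this⟩ = x e :=
      congrArg x (Subtype.ext (mk_endpoints e))
    simp [initialDist, edgeWeight, this, this.ne, hx]
  · refine trivialCut_of_connected hT.2.1 (fun u v huv => ?_) p q
    exact uncut_endpoints hS (hT.1 huv) (by simpa using huv)

-- The chosen edges form a connected subgraph; any spanning tree inside it weighs no more, weights
-- being nonnegative.
open Classical in
lemma exists_treeWeight_le_attachCost [Fintype V] (hG : G.Connected) :
    ∃ T, IsSpanningTree G T ∧
      treeWeight x T ≤ attachCost (bottleneckDist G x) (Finset.univ : Finset V).toList := by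
  obtain ⟨s, hsum, hs⟩ := exists_sum_le_attachCost
    ((bottleneckRealized_initialDist (x := x) hG).relaxAll (Finset.univ : Finset V).toList)
    (Finset.univ : Finset V).toList (fun _ _ => False)
    (fun S _ h p q => h p (by simp) q (by simp))
  let H : SimpleGraph V := SimpleGraph.fromEdgeSet (Subtype.val '' (s : Set G.edgeSet))
  have hadj : ∀ {u v}, H.Adj u v → ∃ h : G.Adj u v, ⟨s(u, v), h⟩ ∈ s := by
    intro u v h
    obtain ⟨⟨e, he, heq⟩, -⟩ := (SimpleGraph.fromEdgeSet_adj _).1 h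
    have h' : G.Adj u v := by
      rw [← SimpleGraph.mem_edgeSet, ← heq]
      exact e.2
    refine ⟨h', ?_⟩
    have : e = ⟨s(u, v), h'⟩ := Subtype.ext heq
    exact this ▸ he
  have hH : H.Connected := by
    refine (SimpleGraph.connected_iff H).2 ⟨fun u v => ?_, hG.nonempty⟩
    -- The component of u is a cut that no chosen edge crosses.
    refine (hs (fun w => H.Reachable u w) (by simp) (fun e he => ?_) u v).1 (.refl u)
    have : H.Adj (endpoints e).1 (endpoints e).2 :=
      (SimpleGraph.fromEdgeSet_adj _).2 ⟨⟨e, he, (mk_endpoints e).symm⟩, (adj_endpoints e).ne⟩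
    exact ⟨fun h => h.trans this.reachable, fun h => h.trans this.symm.reachable⟩
  obtain ⟨T, hTH, hT⟩ := hH.exists_isTree_le
  refine ⟨T, ⟨fun u v h => (hadj (hTH h)).1, hT⟩, le_trans ?_ hsum⟩
  unfold treeWeight
  refine Finset.sum_le_sum_of_subset fun e he => ?_
  have he' := (Finset.mem_filter.1 he).2
  rw [← mk_endpoints e, SimpleGraph.mem_edgeSet] at he'
  obtain ⟨h, hmem⟩ := hadj (hTH he')
  have : (⟨s((endpoints e).1, (endpoints e).2), h⟩ : G.edgeSet) = e :=
    Subtype.ext (mk_endpoints e)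
  exact this ▸ hmem

lemma isMSTWeight_attachCost [Fintype V] (hG : G.Connected) :
    IsMSTWeight G x (attachCost (bottleneckDist G x) (Finset.univ : Finset V).toList) := by
  constructor
  · obtain ⟨T, hT, hle⟩ := exists_treeWeight_le_attachCost (x := x) hG
    exact ⟨T, hT, le_antisymm hle (attachCost_le_treeWeight hT)⟩
  · rintro _ ⟨T, hT, rfl⟩
    exact attachCost_le_treeWeight hT

end Graph

/-! ### The number of operations -/

section Complexity

variable {V : Type u} {ι : Type v} {N : ℕ} {F : Set ((ι → ℝ≥0) → ℝ≥0)}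
  {D : (ι → ℝ≥0) → V → V → ℝ≥0}

lemma PureComputable.relax [Fintype V] (h : PureComputable N F)
    (hD : ∀ u v, (fun x => D x u v) ∈ F) (w : V) :
    PureComputable (N + 2 * Fintype.card V ^ 2)
      {e | ∃ u v, e = fun x => relax w (D x) u v} := by
  have hlen : (Finset.univ : Finset (V × V)).toList.length = Fintype.card V ^ 2 := by
    simp [sq]
  have h1 := h.layer .max (fun (p : V × V) x => D x p.1 w) (fun p x => D x w p.2)
    Finset.univ.toList fun p _ => ⟨hD _ _, hD _ _⟩
  have h2 := h1.layer .min (fun (p : V × V) x => D x p.1 p.2)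
    (fun p x => PureOp.max.apply (D x p.1 w) (D x w p.2)) Finset.univ.toList
    fun p _ => ⟨Or.inl (hD _ _), Or.inr ⟨p, by simp, rfl⟩⟩
  refine h2.mono (by omega) ?_
  rintro e ⟨u, v, rfl⟩
  exact Or.inr ⟨(u, v), by simp, rfl⟩

lemma PureComputable.relaxAll [Fintype V] (h : PureComputable N F)
    (hD : ∀ u v, (fun x => D x u v) ∈ F) (l : List V) :
    PureComputable (N + l.length * (2 * Fintype.card V ^ 2))
      {e | ∃ u v, e = fun x => relaxAll l (D x) u v} := by
  induction l with
  | nil =>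
    refine h.mono (by simp) ?_
    rintro e ⟨u, v, rfl⟩
    exact hD u v
  | cons w l ih =>
    refine (ih.relax (D := fun x => _root_.relaxAll l (D x)) (fun u v => ⟨u, v, rfl⟩) w).mono
      (by simp only [List.length_cons]; ring_nf; rfl) subset_rfl

lemma PureComputable.attachCost (h : PureComputable N F) (h0 : (fun _ => 0) ∈ F)
    (hD : ∀ u v, (fun x => D x u v) ∈ F) :
    ∀ l : List V, PureComputable (N + l.length ^ 2)
      (insert (fun x => attachCost (D x) l) F)
  | [] => h.mono (by simp) (by
      rintro e (rfl | he)
      exacts [h0, he])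
  | [_] => h.mono (by simp) (by
      rintro e (rfl | he)
      exacts [h0, he])
  | v :: u :: l => by
    have ih := PureComputable.attachCost h h0 hD (u :: l)
    have h1 := ih.foldr .min (fun w x => D x v w) (Or.inr (hD v u)) l fun w _ => Or.inr (hD v w)
    refine (h1.op .add (Or.inl rfl) (Or.inr (Or.inl rfl))).mono ?_ ?_
    · simp only [List.length_cons]
      -- The head costs `l.length` minima and one addition: (k+1)^2 + k + 1 ≤ (k+2)^2 with k =
      -- `l.length`.
      nlinarith
    · rintro e (rfl | he)
      · exact Or.inl rfl
      · exact Or.inr (Or.inr (Or.inr he))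

end Complexity

lemma pureComputable_initialDist {V : Type u} [Fintype V] (G : SimpleGraph V) :
    PureComputable (Fintype.card V ^ 2)
      (insert (fun _ => 0) {e | ∃ u v, e = fun x => initialDist G x u v}) := by
  have h := (PureComputable.inputs (ι := G.edgeSet)).foldr .max
    (fun (p : V × V) x => edgeWeight G x 0 p.1 p.2) (Or.inl rfl) Finset.univ.toList
    (fun p _ => by
      by_cases hp : G.Adj p.1 p.2
      · exact Or.inr ⟨⟨s(p.1, p.2), hp⟩, by simp [edgeWeight, hp]⟩
      · exact Or.inl (by simp [edgeWeight, hp]))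
  refine h.mono (by simp [sq]) ?_
  rintro e (rfl | ⟨u, v, rfl⟩)
  · exact Or.inr (Or.inl rfl)
  by_cases huv : u = v
  · exact Or.inr (Or.inl (by simp [initialDist, huv]))
  by_cases hadj : G.Adj u v
  · exact Or.inr (Or.inr ⟨⟨s(u, v), hadj⟩, by simp [initialDist, edgeWeight, huv, hadj]⟩)
  · exact Or.inl (by simp [initialDist, edgeWeight, huv, hadj, maxWeight, PureOp.apply])

theorem theorem2 :
    ∃ C : ℕ, ∀ (V : Type u) [Fintype V] (G : SimpleGraph V), G.Connected →
      ∃ A : PureAlgorithm G.edgeSet, A.SolvesMST ∧ A.numOps ≤ C * Fintype.card V ^ 3 := by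
  -- n^2 operations for the maximum weight, 2n^3 for Floyd–Warshall and n^2 for attaching; n ≥ 1
  -- bounds the sum by 4n^3.
  refine ⟨4, fun V _ G hG => ?_⟩
  have hinit := pureComputable_initialDist G
  have hdist := hinit.relaxAll (D := fun x => initialDist G x) (fun u v => Or.inr ⟨u, v, rfl⟩)
    (Finset.univ : Finset V).toList
  obtain ⟨r⟩ := hG.nonempty
  -- The relaxed table no longer lists the constant 0, which is recovered as a diagonal entry.
  have hzero : (fun _ => 0) ∈ {e | ∃ u v, e = fun x => relaxAll
      (Finset.univ : Finset V).toList (initialDist G x) u v} :=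
    ⟨r, r, funext fun x => (relaxAll_self (by simp [initialDist]) _ r).symm⟩
  have hcost := hdist.attachCost
    (D := fun x => relaxAll (Finset.univ : Finset V).toList (initialDist G x)) hzero
    (fun u v => ⟨u, v, rfl⟩) (Finset.univ : Finset V).toList
  obtain ⟨A, hA, heval⟩ := hcost.exists_algorithm (Or.inl rfl)
  refine ⟨A, fun x => ?_, hA.trans ?_⟩
  · rw [heval]
    exact isMSTWeight_attachCost hG
  · have hpos : 0 < Fintype.card V := Fintype.card_pos_iff.2 ⟨r⟩
    have hle : Fintype.card V ^ 2 ≤ Fintype.card V ^ 3 := Nat.pow_le_pow_right hpos (by norm_num)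
    simp only [Finset.length_toList, Finset.card_univ]
    nlinarith
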